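/- Let $L,d,c,g,\rho>0$ and $P_{atm}\in\mathbb R$. Consider a smooth, $L$-periodic, irrotational steady gravity wave over the flat bed $y=-d$, described in the frame moving with the wave speed $c$: the free surface $y=\eta(x)$ is a smooth $L$-periodic function with $\eta>-d$ and $\int_0^L\eta\,dx=0$ (so $d$ is the mean depth), and the velocity field $(u,v)$ and the pressure $P$ are smooth up to the boundary on $D=\{(x,y): -d\le y\le\eta(x)\}$, $L$-periodic in $x$, and satisfy $$(u-c)u_x+vu_y=-\tfrac1\rho P_x,\quad (u-c)v_x+vv_y=-\tfrac1\rho P_y-g,\quad u_x+v_y=0,\quad u_y=v_x\quad\text{in } D,$$ $$v=0\ \text{ on } y=-d,\qquad v=(u-c)\eta_x\ \text{ and }\ P=P_{atm}\ \text{ on } y=\eta(x).$$ Let $k=\frac1L\int_0^L u(x,-d)\,dx$ be the strength of the underlying current, assume $k\ne0$, and let $p=P-(P_{atm}-\rho g y)$ be the dynamic pressure. (1) Suppose that $k\neq c$ and that the wave is a regular wave train with crest at $x=0$ and trough at $x=L/2$, that is, $\eta$ is strictly decreasing on $[0,L/2]$, and $\eta,u,P$ are even and $v$ is odd in $x$.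 Then $p$ attains its maximum over $D$ at the wave crest $(0,\eta(0))$ and its minimum over $D$ at the wave trough $(L/2,\eta(L/2))$. (2) If $k=c$, the flow is trivial: $\eta\equiv0$, and $u=c$, $v=0$ and $p=0$ throughout $D$. (3) If $k>c$, then $u>c$ throughout $D$; if $k<c$, then $u<c$ throughout $D$. -/

import Mathlib

open Set
open scoped ContDiff

namespace WaterWave

/-- The closed fluid domain between the flat bed `y = -d` and the free surface `y = η x`. -/
def fluidDomain (d : ℝ) (η : ℝ → ℝ) : Set (ℝ × ℝ) :=
  {z | -d ≤ z.2 ∧ z.2 ≤ η z.1}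

/-- Partial derivative in `x` on the (closed) set `D`, one-sided where necessary. -/
noncomputable def partialX (D : Set (ℝ × ℝ)) (f : ℝ × ℝ → ℝ) (z : ℝ × ℝ) : ℝ :=
  fderivWithin ℝ f D z (1, 0)

/-- Partial derivative in `y` on the (closed) set `D`, one-sided where necessary. -/
noncomputable def partialY (D : Set (ℝ × ℝ)) (f : ℝ × ℝ → ℝ) (z : ℝ × ℝ) : ℝ :=
  fderivWithin ℝ f D z (0, 1)

/-- A smooth `L`-periodic irrotational steady gravity wave over a flat bed, in the frame moving with
the wave speed `c`: free surface `η`, velocity field `(u, v)`, pressure `P`.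
Smoothness of `u, v, P` is smoothness up to the boundary of the fluid domain; all conditions only
involve values at points of the fluid domain. -/
structure IsSteadyWave (L d c g ρ Patm : ℝ) (η : ℝ → ℝ) (u v P : ℝ × ℝ → ℝ) : Prop where
  smooth_η : ContDiff ℝ ∞ η
  smooth_u : ContDiffOn ℝ ∞ u (fluidDomain d η)
  smooth_v : ContDiffOn ℝ ∞ v (fluidDomain d η)
  smooth_P : ContDiffOn ℝ ∞ P (fluidDomain d η)
  above_bed : ∀ x, -d < η x
  /-- the mean surface level is `y = 0`, so that `d` is the mean water depth -/
  mean_level : ∫ x in (0 : ℝ)..L, η x = 0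
  periodic_η : ∀ x, η (x + L) = η x
  periodic_u : ∀ x y, (x, y) ∈ fluidDomain d η → u (x + L, y) = u (x, y)
  periodic_v : ∀ x y, (x, y) ∈ fluidDomain d η → v (x + L, y) = v (x, y)
  periodic_P : ∀ x y, (x, y) ∈ fluidDomain d η → P (x + L, y) = P (x, y)
  euler_x : ∀ z ∈ fluidDomain d η,
    (u z - c) * partialX (fluidDomain d η) u z + v z * partialY (fluidDomain d η) u z =
      -(1 / ρ) * partialX (fluidDomain d η) P z
  euler_y : ∀ z ∈ fluidDomain d η,
    (u z - c) * partialX (fluidDomain d η) v z + v z * partialY (fluidDomain d η) v z =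
      -(1 / ρ) * partialY (fluidDomain d η) P z - g
  incompressible : ∀ z ∈ fluidDomain d η,
    partialX (fluidDomain d η) u z + partialY (fluidDomain d η) v z = 0
  irrotational : ∀ z ∈ fluidDomain d η,
    partialY (fluidDomain d η) u z = partialX (fluidDomain d η) v z
  bed : ∀ x, v (x, -d) = 0
  surface_kinematic : ∀ x, v (x, η x) = (u (x, η x) - c) * deriv η x
  surface_dynamic : ∀ x, P (x, η x) = Patm

/-- A regular wave train: a smooth steady wave whose surface is strictly monotone between the
crest `x = 0` and the troughs `x = ± L / 2`, and which is symmetric about the crest line. -/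
structure IsRegularWaveTrain (L d c g ρ Patm : ℝ) (η : ℝ → ℝ) (u v P : ℝ × ℝ → ℝ) : Prop
    extends IsSteadyWave L d c g ρ Patm η u v P where
  strictAnti_η : StrictAntiOn η (Icc 0 (L / 2))
  symm_η : ∀ x, η (-x) = η x
  symm_u : ∀ x y, (x, y) ∈ fluidDomain d η → u (-x, y) = u (x, y)
  symm_P : ∀ x y, (x, y) ∈ fluidDomain d η → P (-x, y) = P (x, y)
  antisymm_v : ∀ x y, (x, y) ∈ fluidDomain d η → v (-x, y) = -v (x, y)

/-- Strength of the underlying current: the mean of `u` along the bed over one period. -/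
noncomputable def currentStrength (L d : ℝ) (u : ℝ × ℝ → ℝ) : ℝ :=
  (1 / L) * ∫ x in (0 : ℝ)..L, u (x, -d)

/-- Dynamic pressure: total pressure minus hydrostatic pressure `Patm - ρ g y`. -/
def dynamicPressure (g ρ Patm : ℝ) (P : ℝ × ℝ → ℝ) (z : ℝ × ℝ) : ℝ :=
  P z - (Patm - ρ * g * z.2)

end WaterWave

/-!
Write `U = u - c` and let `ψ` be the stream function of the flow, `ψ_y = U`, `ψ_x = -v`, `ψ = 0` on
the bed. The kinematic boundary condition makes `ψ` constant on the free surface, equal to the total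
flux `m`. Everything is decided by the sign of `m`.

If `m > 0`, comparison of the harmonic function `ψ` with the subharmonic function `exp (y + d)`, and
of `m - ψ` with `exp (α (η x - y))`, which is subharmonic for large `α`, gives a positive lower
bound for `U = ψ_y` on the bed and on the surface (`IsPotentialFlow.exists_pos_le_bed`,
`IsPotentialFlow.exists_pos_le_surface`). These explicit barriers replace the Hopf boundary point
lemma. As `U` is harmonic, the bound extends to the fluid (`IsPotentialFlow.velocity_pos`). The case
`m < 0` is the same for `-U`, and if `m = 0` then `ψ = 0` and the fluid is at rest relative to the
wave. Averaging `U` over the bed shows that `k - c` has the sign of `m`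
(`IsSteadyWave.current_trichotomy`).

By Bernoulli's law the dynamic pressure is a constant minus `ρ (U² + v²) / 2`, and on the surface it
is `ρ g η`. For `m = 0` this forces `η` to be constant, hence zero. For `m ≠ 0` there is no
stagnation point, so `log (U² + v²)` is harmonic; its vertical derivative vanishes on the bed, and hence its
extrema over the fluid lie on the surface (`IsPotentialFlow.mul_log_speed_le`), at the highest and
the lowest points of `η`.

All maximum principles come from `exists_isMaxOn_boundary`, for functions with strictly positive
Laplacian on the periodic domain; harmonic functions are perturbed by a small multiple of `exp y`.
-/

namespace WaterWave

open Filter Topology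

/-! ### Calculus on the fluid domain -/

section Calculus

variable {d : ℝ} {η : ℝ → ℝ}

theorem eventually_interior (hη : Continuous η) {x y : ℝ} (h₁ : -d < y) (h₂ : y < η x) :
    ∀ᶠ z : ℝ × ℝ in 𝓝 (x, y), -d < z.2 ∧ z.2 < η z.1 :=
  ((isOpen_lt continuous_const continuous_snd).inter
    (isOpen_lt continuous_snd (hη.comp continuous_fst))).mem_nhds ⟨h₁, h₂⟩

theorem fluidDomain_mem_nhds (hη : Continuous η) {x y : ℝ} (h₁ : -d < y) (h₂ : y < η x) :
    fluidDomain d η ∈ 𝓝 (x, y) :=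
  mem_of_superset (eventually_interior hη h₁ h₂) fun _ hz => ⟨hz.1.le, hz.2.le⟩

theorem isClosed_fluidDomain (hη : Continuous η) : IsClosed (fluidDomain d η) :=
  (isClosed_le continuous_const continuous_snd).inter
    (isClosed_le continuous_snd (hη.comp continuous_fst))

/-- Chain rule along a curve that stays in the closed domain, up to the boundary. -/
theorem hasDerivWithinAt_comp_curve {D : Set (ℝ × ℝ)} {f : ℝ × ℝ → ℝ} {a b : ℝ → ℝ}
    {a' b' t : ℝ} {s : Set ℝ} (hf : DifferentiableWithinAt ℝ f D (a t, b t))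
    (ha : HasDerivWithinAt a a' s t) (hb : HasDerivWithinAt b b' s t)
    (hD : ∀ r ∈ s, (a r, b r) ∈ D) :
    HasDerivWithinAt (fun r => f (a r, b r))
      (a' * partialX D f (a t, b t) + b' * partialY D f (a t, b t)) s t := by
  have h := HasFDerivWithinAt.comp_hasDerivWithinAt (f := fun r => (a r, b r)) t
    hf.hasFDerivWithinAt (ha.prodMk hb) hD
  have e : ((a', b') : ℝ × ℝ) = a' • ((1, 0) : ℝ × ℝ) + b' • ((0, 1) : ℝ × ℝ) := by simp
  rw [e, map_add, map_smul, map_smul] at h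
  exact h

/-- Up to the bed and the surface, `partialY` is the one-sided derivative along vertical segments. -/
theorem hasDerivWithinAt_vertical {f : ℝ × ℝ → ℝ}
    (hf : ContDiffOn ℝ ∞ f (fluidDomain d η)) {x y : ℝ} (hz : (x, y) ∈ fluidDomain d η) :
    HasDerivWithinAt (fun s => f (x, s)) (partialY (fluidDomain d η) f (x, y))
      (Icc (-d) (η x)) y := by
  simpa using hasDerivWithinAt_comp_curve (a := fun _ => x) (b := fun s => s)
    ((hf.differentiableOn (by simp)) _ hz) (hasDerivWithinAt_const y (Icc (-d) (η x)) x)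
    (hasDerivWithinAt_id y (Icc (-d) (η x))) fun r hr => hr

theorem hasDerivAt_fst {D : Set (ℝ × ℝ)} {f : ℝ × ℝ → ℝ} {x y : ℝ} (hD : D ∈ 𝓝 (x, y))
    (hf : DifferentiableAt ℝ f (x, y)) :
    HasDerivAt (fun s => f (s, y)) (partialX D f (x, y)) x := by
  have h := HasFDerivAt.comp_hasDerivAt (f := fun s : ℝ => (s, y)) x hf.hasFDerivAt
    ((hasDerivAt_id x).prodMk (hasDerivAt_const x y))
  rw [← fderivWithin_of_mem_nhds hD] at h
  exact h

theorem hasDerivAt_snd {D : Set (ℝ × ℝ)} {f : ℝ × ℝ → ℝ} {x y : ℝ} (hD : D ∈ 𝓝 (x, y))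
    (hf : DifferentiableAt ℝ f (x, y)) :
    HasDerivAt (fun s => f (x, s)) (partialY D f (x, y)) y := by
  have h := HasFDerivAt.comp_hasDerivAt (f := fun s : ℝ => (x, s)) y hf.hasFDerivAt
    ((hasDerivAt_const y x).prodMk (hasDerivAt_id y))
  rw [← fderivWithin_of_mem_nhds hD] at h
  exact h

theorem partialX_neg {D : Set (ℝ × ℝ)} {f : ℝ × ℝ → ℝ} {z : ℝ × ℝ} (hD : D ∈ 𝓝 z) :
    partialX D (fun w => -f w) z = -partialX D f z := by
  simp only [partialX, fderivWithin_of_mem_nhds hD]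
  rw [fderiv_fun_neg]; rfl

theorem partialY_neg {D : Set (ℝ × ℝ)} {f : ℝ × ℝ → ℝ} {z : ℝ × ℝ} (hD : D ∈ 𝓝 z) :
    partialY D (fun w => -f w) z = -partialY D f z := by
  simp only [partialY, fderivWithin_of_mem_nhds hD]
  rw [fderiv_fun_neg]; rfl

/-- The directional derivative of `f` along `a` is differentiable inside `D`; its derivative is
given by the second derivative of `f`. -/
theorem hasFDerivAt_fderivWithin_apply {D : Set (ℝ × ℝ)} {f : ℝ × ℝ → ℝ} {z : ℝ × ℝ} (hD : D ∈ 𝓝 z)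
    (hf : ContDiffAt ℝ 2 f z) (a : ℝ × ℝ) :
    HasFDerivAt (fun w => fderivWithin ℝ f D w a)
      ((ContinuousLinearMap.apply ℝ ℝ a).comp (fderiv ℝ (fderiv ℝ f) z)) z := by
  have h1 : DifferentiableAt ℝ (fderiv ℝ f) z :=
    (hf.fderiv_right (m := 1) (by norm_num)).differentiableAt (by norm_num)
  have h2 := (ContinuousLinearMap.apply ℝ ℝ a).hasFDerivAt.comp z h1.hasFDerivAt
  refine h2.congr_of_eventuallyEq ?_
  filter_upwards [eventually_mem_nhds_iff.2 hD] with w hw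
  rw [fderivWithin_of_mem_nhds hw]; rfl

theorem differentiableAt_partialX {D : Set (ℝ × ℝ)} {f : ℝ × ℝ → ℝ} {z : ℝ × ℝ} (hD : D ∈ 𝓝 z)
    (hf : ContDiffAt ℝ 2 f z) : DifferentiableAt ℝ (partialX D f) z :=
  (hasFDerivAt_fderivWithin_apply hD hf (1, 0)).differentiableAt

theorem differentiableAt_partialY {D : Set (ℝ × ℝ)} {f : ℝ × ℝ → ℝ} {z : ℝ × ℝ} (hD : D ∈ 𝓝 z)
    (hf : ContDiffAt ℝ 2 f z) : DifferentiableAt ℝ (partialY D f) z :=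
  (hasFDerivAt_fderivWithin_apply hD hf (0, 1)).differentiableAt

theorem partialX_partialY_comm {D : Set (ℝ × ℝ)} {f : ℝ × ℝ → ℝ} {z : ℝ × ℝ} (hD : D ∈ 𝓝 z)
    (hf : ContDiffAt ℝ 2 f z) : partialX D (partialY D f) z = partialY D (partialX D f) z := by
  have hx := (hasFDerivAt_fderivWithin_apply hD hf (1, 0)).fderiv
  have hy := (hasFDerivAt_fderivWithin_apply hD hf (0, 1)).fderiv
  have hs := hf.isSymmSndFDerivAt (by simp) (1, 0) (0, 1)
  change fderivWithin ℝ (fun w => fderivWithin ℝ f D w (0, 1)) D z (1, 0) =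
    fderivWithin ℝ (fun w => fderivWithin ℝ f D w (1, 0)) D z (0, 1)
  rw [fderivWithin_of_mem_nhds hD, fderivWithin_of_mem_nhds hD, hx, hy]
  exact hs

end Calculus

/-! ### The maximum principle in a periodic strip -/

theorem second_deriv_nonpos_of_isLocalMax {f f' : ℝ → ℝ} {t A : ℝ} (hmax : IsLocalMax f t)
    (hf : ∀ᶠ s in 𝓝 t, HasDerivAt f (f' s) s) (hA : HasDerivAt f' A t) : A ≤ 0 := by
  by_contra! hpos
  have hd : deriv f =ᶠ[𝓝 t] f' := hf.mono fun s hs => hs.deriv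
  have h2 : deriv (deriv f) t = A := by rw [hd.deriv_eq, hA.deriv]
  have h0 : deriv f t = 0 := hmax.deriv_eq_zero
  have hmin := isLocalMin_of_deriv_deriv_pos (h2 ▸ hpos) h0 hf.self_of_nhds.continuousAt
  -- a point that is both a local maximum and a local minimum has constant germ
  have hc : f =ᶠ[𝓝 t] fun _ => f t := by
    filter_upwards [hmax, hmin] with s h1 h3 using le_antisymm h1 h3
  have h4 : deriv f =ᶠ[𝓝 t] fun _ => 0 := by simpa using hc.deriv
  have h5 : deriv (deriv f) t = 0 := by simpa using h4.deriv_eq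
  linarith

section MaximumPrinciple

variable {L d : ℝ} {η : ℝ → ℝ}

/-- By periodicity the maximum over one period, a compact set, is a maximum over the fluid. -/
theorem exists_isMaxOn_of_periodic (hL : 0 < L) (hη : Continuous η) (hab : ∀ x, -d < η x)
    (hper : ∀ x, η (x + L) = η x) {F : ℝ × ℝ → ℝ} (hF : ContinuousOn F (fluidDomain d η))
    (hFper : ∀ x y, (x, y) ∈ fluidDomain d η → F (x + L, y) = F (x, y)) :
    ∃ z ∈ fluidDomain d η, IsMaxOn F (fluidDomain d η) z := by
  set D := fluidDomain d η with hD
  obtain ⟨M, hM⟩ := (isCompact_Icc (a := (0 : ℝ)) (b := L)).bddAbove_image hη.continuousOn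
  have hK : IsCompact (D ∩ Icc (0 : ℝ) L ×ˢ Icc (-d) M) :=
    (isCompact_Icc.prod isCompact_Icc).inter_left (isClosed_fluidDomain hη)
  have hM0 : -d ≤ M := (hab 0).le.trans (hM ⟨0, ⟨le_rfl, hL.le⟩, rfl⟩)
  obtain ⟨z, hz, hmax⟩ := hK.exists_isMaxOn
    ⟨(0, -d), ⟨le_rfl, (hab 0).le⟩, ⟨⟨le_rfl, hL.le⟩, ⟨le_rfl, hM0⟩⟩⟩ (hF.mono inter_subset_left)
  refine ⟨z, hz.1, fun w hw => ?_⟩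
  obtain ⟨x, y⟩ := w
  obtain ⟨n, hn, -⟩ := existsUnique_add_zsmul_mem_Ico hL x 0
  have hmem : ∀ s, (s, y) ∈ D ↔ (s + L, y) ∈ D := fun s => by
    simp only [hD, fluidDomain, mem_ofPred_eq, hper]
  have hP : Function.Periodic (fun s => D.indicator F (s, y)) L := fun s => by
    by_cases h : (s, y) ∈ D
    · simp only [indicator_of_mem h, indicator_of_mem ((hmem s).1 h), hFper s y h]
    · simp only [indicator_of_notMem h, indicator_of_notMem (mt (hmem s).2 h)]
  have hη' : η (x + n • L) = η x := (show Function.Periodic η L from hper).zsmul n x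
  have hw' : (x + n • L, y) ∈ D := ⟨hw.1, by simpa only [hη'] using hw.2⟩
  have e : F (x + n • L, y) = F (x, y) := by
    have := hP.zsmul n x
    simpa only [indicator_of_mem hw, indicator_of_mem hw'] using this
  have hx : x + n • L ∈ Icc 0 L := ⟨hn.1, by simpa using hn.2.le⟩
  have := hmax ⟨hw', hx, hw'.1, hw'.2.trans (hM ⟨_, hx, rfl⟩)⟩
  simpa only [mem_ofPred_eq, e] using this

/-- A periodic function with positive Laplacian in the fluid takes its maximum on the bed or on
the free surface. `Fx` and `Fy` stand for the first partial derivatives. -/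
theorem exists_isMaxOn_boundary (hL : 0 < L) (hη : Continuous η) (hab : ∀ x, -d < η x)
    (hper : ∀ x, η (x + L) = η x) {F Fx Fy : ℝ × ℝ → ℝ} (hF : ContinuousOn F (fluidDomain d η))
    (hFper : ∀ x y, (x, y) ∈ fluidDomain d η → F (x + L, y) = F (x, y))
    (hFx : ∀ x y, -d < y → y < η x → HasDerivAt (fun s => F (s, y)) (Fx (x, y)) x)
    (hFy : ∀ x y, -d < y → y < η x → HasDerivAt (fun s => F (x, s)) (Fy (x, y)) y)
    (hlap : ∀ x y, -d < y → y < η x → ∃ A B, HasDerivAt (fun s => Fx (s, y)) A x ∧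
      HasDerivAt (fun s => Fy (x, s)) B y ∧ 0 < A + B) :
    ∃ z ∈ fluidDomain d η, IsMaxOn F (fluidDomain d η) z ∧ (z.2 = -d ∨ z.2 = η z.1) := by
  obtain ⟨⟨x, y⟩, hz, hmax⟩ := exists_isMaxOn_of_periodic hL hη hab hper hF hFper
  refine ⟨(x, y), hz, hmax, ?_⟩
  by_contra! hcon
  have h₁ : -d < y := lt_of_le_of_ne hz.1 (Ne.symm hcon.1)
  have h₂ : y < η x := lt_of_le_of_ne hz.2 hcon.2
  obtain ⟨A, B, hA, hB, hpos⟩ := hlap x y h₁ h₂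
  have hloc : IsLocalMax F (x, y) := hmax.isLocalMax (fluidDomain_mem_nhds hη h₁ h₂)
  have hev := eventually_interior hη h₁ h₂
  have cx : ContinuousAt (fun s : ℝ => (s, y)) x := by fun_prop
  have cy : ContinuousAt (fun s : ℝ => (x, s)) y := by fun_prop
  have hA' : A ≤ 0 := second_deriv_nonpos_of_isLocalMax (f := fun s => F (s, y))
    (cx.eventually hloc) ((cx.eventually hev).mono fun s hs => hFx s y hs.1 hs.2) hA
  have hB' : B ≤ 0 := second_deriv_nonpos_of_isLocalMax (f := fun s => F (x, s))
    (cy.eventually hloc) ((cy.eventually hev).mono fun s hs => hFy x s hs.1 hs.2) hB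
  linarith

end MaximumPrinciple

/-! ### Plane potential flows and their stream function -/

/-- A periodic plane potential flow `(U, v)` between the flat bed `y = -d` and the streamline
`y = η x`. The differential equations are only required in the interior of the fluid. -/
structure IsPotentialFlow (L d : ℝ) (η : ℝ → ℝ) (U v : ℝ × ℝ → ℝ) : Prop where
  smooth_η : ContDiff ℝ ∞ η
  smooth_U : ContDiffOn ℝ ∞ U (fluidDomain d η)
  smooth_v : ContDiffOn ℝ ∞ v (fluidDomain d η)
  above_bed : ∀ x, -d < η x
  periodic_η : ∀ x, η (x + L) = η x
  periodic_U : ∀ x y, (x, y) ∈ fluidDomain d η → U (x + L, y) = U (x, y)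
  periodic_v : ∀ x y, (x, y) ∈ fluidDomain d η → v (x + L, y) = v (x, y)
  incompressible : ∀ x y, -d < y → y < η x →
    partialY (fluidDomain d η) v (x, y) = -partialX (fluidDomain d η) U (x, y)
  irrotational : ∀ x y, -d < y → y < η x →
    partialX (fluidDomain d η) v (x, y) = partialY (fluidDomain d η) U (x, y)
  bed : ∀ x, v (x, -d) = 0
  surface : ∀ x, v (x, η x) = U (x, η x) * deriv η x

/-- The stream function `ψ (x, y) = ∫ U (x, s) ds` over `-d ≤ s ≤ y`. The integrand is clamped to
the fluid, which makes it continuous on the whole plane and does not change it in the fluid. -/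
noncomputable def streamFunction (d : ℝ) (η : ℝ → ℝ) (U : ℝ × ℝ → ℝ) (z : ℝ × ℝ) : ℝ :=
  ∫ s in (-d)..z.2, U (z.1, max (-d) (min s (η z.1)))

section OneSided

theorem deriv_nonpos_of_max_left {f : ℝ → ℝ} {f' a b : ℝ} (hab : a < b)
    (hf : HasDerivWithinAt f f' (Icc a b) a) (hmax : ∀ s ∈ Icc a b, f s ≤ f a) : f' ≤ 0 := by
  have h := IsLocalMaxOn.hasFDerivWithinAt_nonpos (IsMaxOn.localize hmax) hf.hasFDerivWithinAt
    (sub_mem_posTangentConeAt_of_segment_subset (y := b) (by rw [segment_eq_Icc hab.le]))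
  have h' : (b - a) * f' ≤ 0 := by simpa using h
  nlinarith [sub_pos.2 hab]

theorem deriv_nonneg_of_max_right {f : ℝ → ℝ} {f' a b : ℝ} (hab : a < b)
    (hf : HasDerivWithinAt f f' (Icc a b) b) (hmax : ∀ s ∈ Icc a b, f s ≤ f b) : 0 ≤ f' := by
  have h := IsLocalMaxOn.hasFDerivWithinAt_nonpos (IsMaxOn.localize hmax) hf.hasFDerivWithinAt
    (sub_mem_posTangentConeAt_of_segment_subset (y := a)
      (by rw [segment_symm, segment_eq_Icc hab.le]))
  have h' : (a - b) * f' ≤ 0 := by simpa using h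
  nlinarith [sub_pos.2 hab]

end OneSided

namespace IsPotentialFlow

variable {L d : ℝ} {η : ℝ → ℝ} {U v : ℝ × ℝ → ℝ}

theorem neg (h : IsPotentialFlow L d η U v) :
    IsPotentialFlow L d η (fun z => -U z) (fun z => -v z) where
  smooth_η := h.smooth_η
  smooth_U := h.smooth_U.neg
  smooth_v := h.smooth_v.neg
  above_bed := h.above_bed
  periodic_η := h.periodic_η
  periodic_U x y hz := by rw [h.periodic_U x y hz]
  periodic_v x y hz := by rw [h.periodic_v x y hz]
  incompressible x y h₁ h₂ := by
    have hD := fluidDomain_mem_nhds h.smooth_η.continuous h₁ h₂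
    rw [partialX_neg hD, partialY_neg hD, h.incompressible x y h₁ h₂]
  irrotational x y h₁ h₂ := by
    have hD := fluidDomain_mem_nhds h.smooth_η.continuous h₁ h₂
    rw [partialX_neg hD, partialY_neg hD, h.irrotational x y h₁ h₂]
  bed x := by simp [h.bed x]
  surface x := by simp [h.surface x]

/-- The flux below a curve `y = β x` changes at the rate at which fluid crosses the curve.
Rescaling the vertical segments to `[0, 1]` allows `β = η`, where the domain of `U` ends. -/
theorem hasDerivAt_flux (h : IsPotentialFlow L d η U v) {β : ℝ → ℝ} {x₀ : ℝ}
    (hβ : ContDiff ℝ ∞ β) (hβ₀ : -d < β x₀) (hβD : ∀ᶠ x in 𝓝 x₀, -d ≤ β x ∧ β x ≤ η x) :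
    HasDerivAt (fun x => ∫ s in (-d)..β x, U (x, s))
      (deriv β x₀ * U (x₀, β x₀) - v (x₀, β x₀)) x₀ := by
  obtain ⟨δ, hδ, hball⟩ := Metric.eventually_nhds_iff_ball.1 hβD
  set I := Icc (x₀ - δ / 2) (x₀ + δ / 2) with hI
  set R : Set (ℝ × ℝ) := I ×ˢ Icc (0 : ℝ) 1 with hR
  set D := fluidDomain d η with hD
  have hx₀I : I ∈ 𝓝 x₀ := Icc_mem_nhds (by linarith) (by linarith)
  have hIβ : ∀ x ∈ I, -d ≤ β x ∧ β x ≤ η x := fun x hx => hball x (by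
    rw [Metric.mem_ball, Real.dist_eq, abs_lt]; constructor <;> linarith [hx.1, hx.2])
  have hmap : ∀ p ∈ R, (p.1, -d + (β p.1 + d) * p.2) ∈ D := by
    rintro ⟨x, t⟩ ⟨hx, ht⟩
    obtain ⟨h₁, h₂⟩ := hIβ x hx
    constructor
    · have : 0 ≤ (β x + d) * t := mul_nonneg (by linarith) ht.1
      simpa using this
    · have : (β x + d) * t ≤ (β x + d) * 1 := mul_le_mul_of_nonneg_left ht.2 (by linarith)
      change -d + (β x + d) * t ≤ η x
      linarith
  have hβd := (hβ.differentiable (by simp)).differentiableAt (x := x₀) |>.hasDerivAt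
  let G : ℝ × ℝ → ℝ := fun p => (β p.1 + d) * U (p.1, -d + (β p.1 + d) * p.2)
  have hG : ContDiffOn ℝ ∞ G R := by
    have hβ₁ : ContDiff ℝ ∞ fun p : ℝ × ℝ => β p.1 + d :=
      (hβ.comp contDiff_fst).add contDiff_const
    refine hβ₁.contDiffOn.mul ?_
    exact h.smooth_U.comp
      (contDiff_fst.prodMk (contDiff_const.add (hβ₁.mul contDiff_snd))).contDiffOn hmap
  have hRu : UniqueDiffOn ℝ R :=
    (uniqueDiffOn_Icc (by linarith)).prod (uniqueDiffOn_Icc one_pos)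
  have hGx : ContinuousOn (partialX R G) R :=
    (hG.continuousOn_fderivWithin hRu (by simp)).clm_apply continuousOn_const
  obtain ⟨C, hC⟩ := (isCompact_Icc.prod isCompact_Icc : IsCompact R).exists_bound_of_continuousOn
    hGx
  have hslice : ∀ x ∈ I, ContinuousOn (fun t => (x, t)) (Icc (0 : ℝ) 1) ∧
      MapsTo (fun t => (x, t)) (Icc (0 : ℝ) 1) R := fun x hx =>
    ⟨by fun_prop, fun t ht => ⟨hx, ht⟩⟩
  have hx₀ : x₀ ∈ I := mem_of_mem_nhds hx₀I
  have hder : ∀ t ∈ Icc (0 : ℝ) 1, ∀ x ∈ Ioo (x₀ - δ / 2) (x₀ + δ / 2),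
      HasDerivAt (fun s => G (s, t)) (partialX R G (x, t)) x := fun t ht x hx => by
    have hxR : (x, t) ∈ R := ⟨Ioo_subset_Icc_self hx, ht⟩
    have := hasDerivWithinAt_comp_curve (a := fun s => s) (b := fun _ => t) (s := I)
      ((hG.differentiableOn (by simp)) _ hxR) (hasDerivWithinAt_id x I)
      (hasDerivWithinAt_const x I t) (fun r hr => ⟨hr, ht⟩)
    simpa using this.hasDerivAt (Icc_mem_nhds hx.1 hx.2)
  have hsub : uIoc (0 : ℝ) 1 ⊆ Icc 0 1 := by
    rw [uIoc_of_le zero_le_one]; exact Ioc_subset_Icc_self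
  obtain ⟨hint, hmain⟩ := intervalIntegral.hasDerivAt_integral_of_dominated_loc_of_deriv_le
    (μ := MeasureTheory.volume) (a := 0) (b := 1) (bound := fun _ => C)
    (F := fun x t => G (x, t)) (F' := fun x t => partialX R G (x, t)) (x₀ := x₀)
    (s := Ioo (x₀ - δ / 2) (x₀ + δ / 2)) (Ioo_mem_nhds (by linarith) (by linarith))
    (by
      filter_upwards [hx₀I] with x hx
      exact ((hG.continuousOn.comp (hslice x hx).1 (hslice x hx).2).mono
        hsub).aestronglyMeasurable measurableSet_uIoc)
    ((hG.continuousOn.comp (hslice x₀ hx₀).1 (hslice x₀ hx₀).2).intervalIntegrable_of_Icc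
      zero_le_one)
    (((hGx.comp (hslice x₀ hx₀).1 (hslice x₀ hx₀).2).mono
        hsub).aestronglyMeasurable measurableSet_uIoc)
    (.of_forall fun t ht x hx => hC _ ⟨Ioo_subset_Icc_self hx, hsub ht⟩)
    intervalIntegrable_const
    (.of_forall fun t ht x hx => hder t (hsub ht) x hx)
  have hfun : (fun x => ∫ s in (-d)..β x, U (x, s)) = fun x => ∫ t in (0 : ℝ)..1, G (x, t) := by
    funext x
    have := intervalIntegral.smul_integral_comp_add_mul (a := 0) (b := 1)
      (fun s => U (x, s)) (β x + d) (-d)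
    simp only [mul_zero, add_zero, mul_one, neg_add_cancel_comm_assoc, smul_eq_mul] at this
    rw [← this, ← intervalIntegral.integral_const_mul]
  rw [hfun]
  refine hmain.congr_deriv ?_
  -- the integrand is the derivative of `t β' U - v` along the vertical segment
  have hpath : ContinuousOn (fun t : ℝ => (x₀, -d + (β x₀ + d) * t)) (Icc 0 1) := by fun_prop
  have hpathD : MapsTo (fun t : ℝ => (x₀, -d + (β x₀ + d) * t)) (Icc 0 1) D :=
    fun t ht => hmap (x₀, t) ⟨hx₀, ht⟩
  rw [intervalIntegral.integral_eq_sub_of_hasDerivAt_of_le zero_le_one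
    (f := fun t => t * deriv β x₀ * U (x₀, -d + (β x₀ + d) * t) - v (x₀, -d + (β x₀ + d) * t))
    ?_ ?_ hint]
  · simp [h.bed]
  · exact ((continuousOn_id.mul continuousOn_const).mul
      (h.smooth_U.continuousOn.comp hpath hpathD)).sub
      (h.smooth_v.continuousOn.comp hpath hpathD)
  · intro t ht
    have hH : 0 < β x₀ + d := by linarith
    have h₁ : -d < -d + (β x₀ + d) * t := by linarith [mul_pos hH ht.1]
    have h₂ : -d + (β x₀ + d) * t < η x₀ := by
      have := mul_lt_mul_of_pos_left ht.2 hH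
      linarith [(hIβ x₀ hx₀).2]
    have hN := fluidDomain_mem_nhds h.smooth_η.continuous h₁ h₂
    have hdU := ((h.smooth_U.contDiffAt hN).differentiableAt (by simp))
    have hdv := ((h.smooth_v.contDiffAt hN).differentiableAt (by simp))
    have hlin : HasDerivAt (fun t : ℝ => -d + (β x₀ + d) * t) (β x₀ + d) t := by
      simpa using ((hasDerivAt_id t).const_mul (β x₀ + d)).const_add (-d)
    have eU := (hasDerivAt_snd hN hdU).comp t hlin
    have ev := (hasDerivAt_snd hN hdv).comp t hlin
    have eT := (((hasDerivAt_id t).mul_const (deriv β x₀)).mul eU).sub ev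
    have hb : HasDerivAt (fun x => β x + d) (deriv β x₀) x₀ := hβd.add_const d
    have hcurve : HasDerivAt (fun x => -d + (β x + d) * t) (deriv β x₀ * t) x₀ := by
      simpa using (hb.mul_const t).const_add (-d)
    have eW : HasDerivAt (fun x => U (x, -d + (β x + d) * t)) _ x₀ :=
      hasDerivWithinAt_univ.1 (hasDerivWithinAt_comp_curve (D := univ)
        hdU.differentiableWithinAt (hasDerivAt_id x₀).hasDerivWithinAt
        hcurve.hasDerivWithinAt (fun _ _ => mem_univ _))
    have eG := hb.mul eW
    have e := (hder t ⟨ht.1.le, ht.2.le⟩ x₀ ⟨by linarith, by linarith⟩).unique eG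
    have eX : partialX univ U (x₀, -d + (β x₀ + d) * t) =
        partialX D U (x₀, -d + (β x₀ + d) * t) := by
      rw [partialX, partialX, fderivWithin_univ, fderivWithin_of_mem_nhds hN]
    have eY : partialY univ U (x₀, -d + (β x₀ + d) * t) =
        partialY D U (x₀, -d + (β x₀ + d) * t) := by
      rw [partialY, partialY, fderivWithin_univ, fderivWithin_of_mem_nhds hN]
    rw [e]
    refine eT.congr_deriv ?_
    simp only [id, eX, eY, h.incompressible x₀ _ h₁ h₂, Function.comp_apply]
    ring

theorem continuous_clamp (h : IsPotentialFlow L d η U v) :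
    Continuous fun z : ℝ × ℝ => U (z.1, max (-d) (min z.2 (η z.1))) := by
  have hη := h.smooth_η.continuous
  exact h.smooth_U.continuousOn.comp_continuous (by fun_prop) fun z =>
    ⟨le_max_left _ _, max_le (h.above_bed _).le (min_le_right _ _)⟩

theorem continuous_streamFunction (h : IsPotentialFlow L d η U v) :
    Continuous (streamFunction d η U) := by
  have hc : Continuous (Function.uncurry fun (z : ℝ × ℝ) (s : ℝ) =>
      U (z.1, max (-d) (min s (η z.1)))) :=
    h.continuous_clamp.comp (f := fun w : (ℝ × ℝ) × ℝ => (w.1.1, w.2)) (by fun_prop)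
  exact intervalIntegral.continuous_parametric_intervalIntegral_of_continuous hc continuous_snd

theorem streamFunction_eq {x y : ℝ} (hz : (x, y) ∈ fluidDomain d η) :
    streamFunction d η U (x, y) = ∫ s in (-d)..y, U (x, s) := by
  refine intervalIntegral.integral_congr fun s hs => ?_
  rw [uIcc_of_le hz.1] at hs
  have : max (-d) (min s (η x)) = s := by
    rw [min_eq_left (hs.2.trans hz.2), max_eq_right hs.1]
  simp only [this]

theorem hasDerivAt_streamFunction_snd (h : IsPotentialFlow L d η U v) {x y : ℝ}
    (hz : (x, y) ∈ fluidDomain d η) :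
    HasDerivAt (fun s => streamFunction d η U (x, s)) (U (x, y)) y := by
  have hc : Continuous fun s => U (x, max (-d) (min s (η x))) :=
    h.continuous_clamp.comp (f := fun s : ℝ => (x, s)) (by fun_prop)
  have := (hc.integral_hasStrictDerivAt (-d) y).hasDerivAt
  have e : max (-d) (min y (η x)) = y := by rw [min_eq_left hz.2, max_eq_right hz.1]
  rwa [e] at this

theorem hasDerivAt_streamFunction_fst (h : IsPotentialFlow L d η U v) {x y : ℝ}
    (h₁ : -d < y) (h₂ : y < η x) :
    HasDerivAt (fun s => streamFunction d η U (s, y)) (-v (x, y)) x := by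
  have hev : ∀ᶠ s in 𝓝 x, y < η s := h.smooth_η.continuous.continuousAt.eventually_const_lt h₂
  have := h.hasDerivAt_flux (β := fun _ => y) (x₀ := x) contDiff_const h₁
    (hev.mono fun s hs => ⟨h₁.le, hs.le⟩)
  simp only [deriv_const, zero_mul, zero_sub] at this
  exact this.congr_of_eventuallyEq (hev.mono fun s hs => streamFunction_eq ⟨h₁.le, hs.le⟩)

theorem streamFunction_bed (x : ℝ) : streamFunction d η U (x, -d) = 0 := by
  simp [streamFunction]

theorem streamFunction_surface (h : IsPotentialFlow L d η U v) (x : ℝ) :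
    streamFunction d η U (x, η x) = streamFunction d η U (0, η 0) := by
  have hD : ∀ x, HasDerivAt (fun x => streamFunction d η U (x, η x)) 0 x := fun x => by
    have := h.hasDerivAt_flux (x₀ := x) h.smooth_η (h.above_bed x)
      (.of_forall fun s => ⟨(h.above_bed s).le, le_rfl⟩)
    rw [h.surface, mul_comm, sub_self] at this
    exact this.congr_of_eventuallyEq
      (.of_forall fun s => streamFunction_eq ⟨(h.above_bed s).le, le_rfl⟩)
  exact is_const_of_deriv_eq_zero (fun x => (hD x).differentiableAt) (fun x => (hD x).deriv) x 0

theorem streamFunction_periodic (h : IsPotentialFlow L d η U v) (x y : ℝ) :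
    streamFunction d η U (x + L, y) = streamFunction d η U (x, y) := by
  simp only [streamFunction, h.periodic_η]
  congr 1
  funext s
  exact h.periodic_U _ _ ⟨le_max_left _ _, max_le (h.above_bed _).le (min_le_right _ _)⟩

theorem contDiffAt_U (h : IsPotentialFlow L d η U v) {x y : ℝ} (h₁ : -d < y) (h₂ : y < η x) :
    ContDiffAt ℝ 2 U (x, y) :=
  contDiffAt_infty.1
    (h.smooth_U.contDiffAt (fluidDomain_mem_nhds h.smooth_η.continuous h₁ h₂)) 2

theorem contDiffAt_v (h : IsPotentialFlow L d η U v) {x y : ℝ} (h₁ : -d < y) (h₂ : y < η x) :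
    ContDiffAt ℝ 2 v (x, y) :=
  contDiffAt_infty.1
    (h.smooth_v.contDiffAt (fluidDomain_mem_nhds h.smooth_η.continuous h₁ h₂)) 2

/-- The first and second derivatives of the velocity in the interior: with `a = U_x`, `b = U_y`
the flow satisfies `v_x = b`, `v_y = -a`, and `a_x = A`, `b_y = -A`, `a_y = b_x = B`. In
particular `U` is harmonic. -/
theorem hasDerivAt_velocity (h : IsPotentialFlow L d η U v) :
    ∃ a b : ℝ × ℝ → ℝ, ∀ x y, -d < y → y < η x →
      HasDerivAt (fun s => U (s, y)) (a (x, y)) x ∧ HasDerivAt (fun s => U (x, s)) (b (x, y)) y ∧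
      HasDerivAt (fun s => v (s, y)) (b (x, y)) x ∧ HasDerivAt (fun s => v (x, s)) (-a (x, y)) y ∧
      ∃ A B, HasDerivAt (fun s => a (s, y)) A x ∧ HasDerivAt (fun s => b (x, s)) (-A) y ∧
        HasDerivAt (fun s => b (s, y)) B x ∧ HasDerivAt (fun s => a (x, s)) B y := by
  set D := fluidDomain d η with hDdef
  refine ⟨partialX D U, partialY D U, fun x y h₁ h₂ => ?_⟩
  have hη := h.smooth_η.continuous
  have hD : D ∈ 𝓝 (x, y) := fluidDomain_mem_nhds hη h₁ h₂
  have cU := h.contDiffAt_U h₁ h₂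
  have cv := h.contDiffAt_v h₁ h₂
  have dU := cU.differentiableAt (by norm_num)
  have dv := cv.differentiableAt (by norm_num)
  have ev := eventually_interior hη h₁ h₂
  have e₁ : partialX D v =ᶠ[𝓝 (x, y)] partialY D U :=
    ev.mono fun w hw => h.irrotational w.1 w.2 hw.1 hw.2
  have e₂ : partialY D v =ᶠ[𝓝 (x, y)] fun w => -partialX D U w :=
    ev.mono fun w hw => h.incompressible w.1 w.2 hw.1 hw.2
  have hYY : partialY D (partialY D U) (x, y) = -partialX D (partialX D U) (x, y) := by
    rw [← partialX_neg hD]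
    have f₁ : partialY D (partialX D v) (x, y) = partialY D (partialY D U) (x, y) := by
      simp only [partialY, fderivWithin_of_mem_nhds hD]
      exact congrArg (fun T : ℝ × ℝ →L[ℝ] ℝ => T (0, 1)) e₁.fderiv_eq
    have f₂ : partialX D (partialY D v) (x, y) = partialX D (fun w => -partialX D U w) (x, y) := by
      simp only [partialX, fderivWithin_of_mem_nhds hD]
      exact congrArg (fun T : ℝ × ℝ →L[ℝ] ℝ => T (1, 0)) e₂.fderiv_eq
    rw [← f₁, ← f₂, partialX_partialY_comm hD cv]
  refine ⟨hasDerivAt_fst hD dU, hasDerivAt_snd hD dU, ?_, ?_,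
    partialX D (partialX D U) (x, y), partialX D (partialY D U) (x, y),
    hasDerivAt_fst hD (differentiableAt_partialX hD cU), ?_,
    hasDerivAt_fst hD (differentiableAt_partialY hD cU), ?_⟩
  · rw [← h.irrotational x y h₁ h₂]; exact hasDerivAt_fst hD dv
  · rw [← h.incompressible x y h₁ h₂]; exact hasDerivAt_snd hD dv
  · rw [← hYY]; exact hasDerivAt_snd hD (differentiableAt_partialY hD cU)
  · rw [partialX_partialY_comm hD cU]; exact hasDerivAt_snd hD (differentiableAt_partialX hD cU)

end IsPotentialFlow

/-! ### The sign of the horizontal velocity -/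

namespace IsPotentialFlow

variable {L d : ℝ} {η : ℝ → ℝ} {U v : ℝ × ℝ → ℝ}

theorem exists_height_bound (h : IsPotentialFlow L d η U v) (hL : 0 < L) :
    ∃ M, ∀ z ∈ fluidDomain d η, z.2 ≤ M := by
  obtain ⟨w, -, hw⟩ := exists_isMaxOn_of_periodic hL h.smooth_η.continuous h.above_bed
    h.periodic_η (F := fun z => z.2) continuous_snd.continuousOn fun _ _ _ => rfl
  exact ⟨w.2, fun z hz => hw hz⟩

/-- A small multiple of `exp y` is the perturbation that makes Laplacians positive. -/
theorem exists_mul_exp_height_le (h : IsPotentialFlow L d η U v) (hL : 0 < L) {ε : ℝ}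
    (hε : 0 < ε) : ∃ δ > 0, ∀ z ∈ fluidDomain d η, δ * Real.exp z.2 ≤ ε := by
  obtain ⟨M, hM⟩ := h.exists_height_bound hL
  refine ⟨ε * Real.exp (-M), by positivity, fun z hz => ?_⟩
  rw [mul_assoc, ← Real.exp_add]
  exact mul_le_of_le_one_right hε.le (Real.exp_le_one_iff.2 (by linarith [hM z hz]))

/-- Lower bound for `U` on the bed, from the barrier `ε (exp (y + d) - 1) ≤ ψ`. -/
theorem exists_pos_le_bed (h : IsPotentialFlow L d η U v) (hL : 0 < L)
    (hm : 0 < streamFunction d η U (0, η 0)) : ∃ ε > 0, ∀ x, ε ≤ U (x, -d) := by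
  obtain ⟨M, hM⟩ := h.exists_height_bound hL
  set m := streamFunction d η U (0, η 0) with hmdef
  obtain ⟨a, b, hab⟩ := h.hasDerivAt_velocity
  set ε := m * Real.exp (-(M + d)) with hε
  have hεpos : 0 < ε := by positivity
  have hεm : ε * Real.exp (M + d) = m := by
    rw [hε, mul_assoc, ← Real.exp_add]; simp
  have hψ := h.continuous_streamFunction
  obtain ⟨w, hw, hmax, hbd⟩ := exists_isMaxOn_boundary hL h.smooth_η.continuous h.above_bed
    h.periodic_η (d := d)
    (F := fun z => ε * Real.exp (z.2 + d) - streamFunction d η U z)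
    (Fx := fun z => v z) (Fy := fun z => ε * Real.exp (z.2 + d) - U z)
    (by fun_prop) (fun x y _ => by simp only [h.streamFunction_periodic])
    (fun x y h₁ h₂ => by
      simpa using (h.hasDerivAt_streamFunction_fst h₁ h₂).const_sub (ε * Real.exp (y + d)))
    (fun x y h₁ h₂ => (((Real.hasDerivAt_exp (y + d)).comp_add_const y d).const_mul ε).sub
      (h.hasDerivAt_streamFunction_snd ⟨h₁.le, h₂.le⟩))
    (fun x y h₁ h₂ => by
      obtain ⟨-, h4, h5, -, -⟩ := hab x y h₁ h₂
      refine ⟨_, _, h5,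
        (((Real.hasDerivAt_exp (y + d)).comp_add_const y d).const_mul ε).sub h4, ?_⟩
      have : 0 < ε * Real.exp (y + d) := by positivity
      linarith)
  have hle : ∀ z ∈ fluidDomain d η,
      ε * Real.exp (z.2 + d) - streamFunction d η U z ≤ ε := fun z hz => by
    refine (hmax hz).trans ?_
    obtain ⟨x, y⟩ := w
    rcases hbd with hbd | hbd <;> dsimp only at hbd ⊢ <;> subst hbd
    · simp [streamFunction_bed]
    · rw [h.streamFunction_surface, ← hmdef]
      have : Real.exp (η x + d) ≤ Real.exp (M + d) :=
        Real.exp_le_exp.2 (by linarith [hM _ hw])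
      nlinarith
  refine ⟨ε, hεpos, fun x => ?_⟩
  have hder := (((Real.hasDerivAt_exp (-d + d)).comp_add_const (-d) d).const_mul ε).sub
    (h.hasDerivAt_streamFunction_snd (x := x) ⟨le_rfl, (h.above_bed x).le⟩)
  have := deriv_nonpos_of_max_left (h.above_bed x) hder.hasDerivWithinAt fun s hs => by
    simpa [streamFunction_bed] using hle (x, s) hs
  simp only [neg_add_cancel, mul_one, Real.exp_zero] at this
  linarith

/-- Lower bound for `U` on the surface, from the barrier `ε (exp (α (η x - y)) - 1) ≤ m - ψ`. -/
theorem exists_pos_le_surface (h : IsPotentialFlow L d η U v) (hL : 0 < L)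
    (hm : 0 < streamFunction d η U (0, η 0)) : ∃ ε > 0, ∀ x, ε ≤ U (x, η x) := by
  obtain ⟨M, hM⟩ := h.exists_height_bound hL
  set m := streamFunction d η U (0, η 0) with hmdef
  obtain ⟨a, b, hab⟩ := h.hasDerivAt_velocity
  have hη₁ : ContDiff ℝ ∞ (deriv η) := (contDiff_infty_iff_deriv.1 h.smooth_η).2
  have hη₂ : ContDiff ℝ ∞ (deriv (deriv η)) := (contDiff_infty_iff_deriv.1 hη₁).2
  have dη : ∀ x, HasDerivAt η (deriv η x) x := fun x =>
    (h.smooth_η.differentiable (by simp)).differentiableAt.hasDerivAt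
  have dη₁ : ∀ x, HasDerivAt (deriv η) (deriv (deriv η) x) x := fun x =>
    (hη₁.differentiable (by simp)).differentiableAt.hasDerivAt
  have hper : ∀ {f : ℝ → ℝ}, (∀ x, f (x + L) = f x) → ∀ x, deriv f (x + L) = deriv f x :=
    fun {f} hf x => by rw [← deriv_comp_add_const, funext hf]
  obtain ⟨K, hK⟩ : ∃ K, ∀ x, -deriv (deriv η) x ≤ K := by
    obtain ⟨w, -, hw⟩ := exists_isMaxOn_of_periodic hL h.smooth_η.continuous h.above_bed
      h.periodic_η (F := fun z => -deriv (deriv η) z.1)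
      (hη₂.continuous.comp continuous_fst).neg.continuousOn
      fun x y _ => by simp only [hper (hper h.periodic_η)]
    exact ⟨_, fun x => hw (show (x, -d) ∈ fluidDomain d η from ⟨le_rfl, (h.above_bed x).le⟩)⟩
  -- `α` is so large that `exp (α (η x - y))` is strictly subharmonic
  obtain ⟨α, hα, hα'⟩ : ∃ α : ℝ, 0 < α ∧ ∀ x, 0 < α + deriv (deriv η) x :=
    ⟨max K 0 + 1, by positivity, fun x => by linarith [hK x, le_max_left K 0]⟩
  set ε := m * Real.exp (-(α * (M + d))) with hε
  have hεpos : 0 < ε := by positivity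
  have hεm : ε * Real.exp (α * (M + d)) = m := by
    rw [hε, mul_assoc, ← Real.exp_add]; simp
  have hψ := h.continuous_streamFunction
  have hηc := h.smooth_η.continuous
  have dEx : ∀ x y, HasDerivAt (fun s => Real.exp (α * (η s - y)))
      (Real.exp (α * (η x - y)) * (α * deriv η x)) x := fun x y =>
    ((((dη x).sub_const y).const_mul α).exp)
  have dEy : ∀ x y, HasDerivAt (fun s => Real.exp (α * (η x - s)))
      (Real.exp (α * (η x - y)) * (α * (-1))) y := fun x y => by
    simpa using ((((hasDerivAt_id y).const_sub (η x)).const_mul α).exp)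
  obtain ⟨w, hw, hmax, hbd⟩ := exists_isMaxOn_boundary hL hηc h.above_bed h.periodic_η (d := d)
    (F := fun z => ε * Real.exp (α * (η z.1 - z.2)) + streamFunction d η U z)
    (Fx := fun z => ε * (Real.exp (α * (η z.1 - z.2)) * (α * deriv η z.1)) + -v z)
    (Fy := fun z => ε * (Real.exp (α * (η z.1 - z.2)) * (α * (-1))) + U z)
    (by fun_prop) (fun x y _ => by simp only [h.streamFunction_periodic, h.periodic_η])
    (fun x y h₁ h₂ => ((dEx x y).const_mul ε).add (h.hasDerivAt_streamFunction_fst h₁ h₂))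
    (fun x y h₁ h₂ => ((dEy x y).const_mul ε).add
      (h.hasDerivAt_streamFunction_snd ⟨h₁.le, h₂.le⟩))
    (fun x y h₁ h₂ => by
      obtain ⟨-, h4, h5, -, -⟩ := hab x y h₁ h₂
      refine ⟨_, _, ((((dEx x y).mul ((dη₁ x).const_mul α)).const_mul ε)).add h5.neg,
        (((dEy x y).mul_const (α * (-1))).const_mul ε).add h4, ?_⟩
      have e1 : 0 < ε * Real.exp (α * (η x - y)) * α := by positivity
      have e2 := mul_pos e1 (hα' x)
      have e3 : 0 ≤ ε * Real.exp (α * (η x - y)) * (α * deriv η x) ^ 2 := by positivity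
      nlinarith)
  have hle : ∀ z ∈ fluidDomain d η,
      ε * Real.exp (α * (η z.1 - z.2)) + streamFunction d η U z ≤ ε + m := fun z hz => by
    refine (hmax hz).trans ?_
    obtain ⟨x, y⟩ := w
    rcases hbd with hbd | hbd <;> dsimp only at hbd ⊢ <;> subst hbd
    · rw [streamFunction_bed]
      have h1 : η x ≤ M := hM (x, η x) ⟨(h.above_bed x).le, le_rfl⟩
      have : Real.exp (α * (η x - -d)) ≤ Real.exp (α * (M + d)) :=
        Real.exp_le_exp.2 (mul_le_mul_of_nonneg_left (by linarith) hα.le)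
      nlinarith
    · rw [h.streamFunction_surface, ← hmdef]
      simp
  refine ⟨ε * α, by positivity, fun x => ?_⟩
  have hder := ((dEy x (η x)).const_mul ε).add
    (h.hasDerivAt_streamFunction_snd (x := x) ⟨(h.above_bed x).le, le_rfl⟩)
  have := deriv_nonneg_of_max_right (h.above_bed x) hder.hasDerivWithinAt fun s hs => by
    simpa [h.streamFunction_surface x, ← hmdef] using hle (x, s) hs
  simp only [sub_self, mul_zero, Real.exp_zero] at this
  linarith

/-- A positive total flux makes the horizontal velocity positive: `U` is harmonic, and it is bounded
below by a positive constant on the bed and on the surface. -/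
theorem velocity_pos (h : IsPotentialFlow L d η U v) (hL : 0 < L)
    (hm : 0 < streamFunction d η U (0, η 0)) : ∀ z ∈ fluidDomain d η, 0 < U z := by
  obtain ⟨ε₁, hε₁, hbed⟩ := h.exists_pos_le_bed hL hm
  obtain ⟨ε₂, hε₂, hsurf⟩ := h.exists_pos_le_surface hL hm
  obtain ⟨a, b, hab⟩ := h.hasDerivAt_velocity
  set ε := min ε₁ ε₂ with hε
  have hεpos : 0 < ε := lt_min hε₁ hε₂
  obtain ⟨δ, hδpos, hδ⟩ := h.exists_mul_exp_height_le hL (half_pos hεpos)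
  obtain ⟨w, hw, hmax, hbd⟩ := exists_isMaxOn_boundary hL h.smooth_η.continuous h.above_bed
    h.periodic_η (d := d)
    (F := fun z => δ * Real.exp z.2 - U z)
    (Fx := fun z => -a z) (Fy := fun z => δ * Real.exp z.2 - b z)
    ((by fun_prop : Continuous fun z : ℝ × ℝ => δ * Real.exp z.2).continuousOn.sub
      h.smooth_U.continuousOn)
    (fun x y hz => by simp only [h.periodic_U x y hz])
    (fun x y h₁ h₂ => (hab x y h₁ h₂).1.const_sub (δ * Real.exp y))
    (fun x y h₁ h₂ => ((Real.hasDerivAt_exp y).const_mul δ).sub (hab x y h₁ h₂).2.1)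
    (fun x y h₁ h₂ => by
      obtain ⟨-, -, -, -, A, B, h5, h6, -, -⟩ := hab x y h₁ h₂
      refine ⟨_, _, h5.neg, ((Real.hasDerivAt_exp y).const_mul δ).sub h6, ?_⟩
      have : 0 < δ * Real.exp y := by positivity
      linarith)
  intro z hz
  have hUw : ε ≤ U w := by
    obtain ⟨x, y⟩ := w
    rcases hbd with hbd | hbd <;> dsimp only at hbd <;> subst hbd
    · exact (min_le_left _ _).trans (hbed x)
    · exact (min_le_right _ _).trans (hsurf x)
  have h1 : δ * Real.exp w.2 ≤ ε / 2 := hδ w hw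
  have h2 : 0 < δ * Real.exp z.2 := by positivity
  have h3 : δ * Real.exp z.2 - U z ≤ δ * Real.exp w.2 - U w := hmax hz
  linarith

/-- If the total flux vanishes, `ψ` is a harmonic function that vanishes on the boundary. -/
theorem streamFunction_nonpos (h : IsPotentialFlow L d η U v) (hL : 0 < L)
    (hm : streamFunction d η U (0, η 0) = 0) :
    ∀ z ∈ fluidDomain d η, streamFunction d η U z ≤ 0 := by
  obtain ⟨a, b, hab⟩ := h.hasDerivAt_velocity
  have hψ := h.continuous_streamFunction
  intro z hz
  refine le_of_forall_pos_le_add fun ε hε => ?_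
  obtain ⟨δ, hδpos, hδ⟩ := h.exists_mul_exp_height_le hL hε
  obtain ⟨w, hw, hmax, hbd⟩ := exists_isMaxOn_boundary hL h.smooth_η.continuous h.above_bed
    h.periodic_η (d := d)
    (F := fun z => δ * Real.exp z.2 + streamFunction d η U z)
    (Fx := fun z => -v z) (Fy := fun z => δ * Real.exp z.2 + U z)
    (by fun_prop) (fun x y _ => by simp only [h.streamFunction_periodic])
    (fun x y h₁ h₂ =>
      (h.hasDerivAt_streamFunction_fst h₁ h₂).const_add (δ * Real.exp y))
    (fun x y h₁ h₂ => ((Real.hasDerivAt_exp y).const_mul δ).add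
      (h.hasDerivAt_streamFunction_snd ⟨h₁.le, h₂.le⟩))
    (fun x y h₁ h₂ => by
      obtain ⟨-, h4, h5, -, -⟩ := hab x y h₁ h₂
      refine ⟨_, _, h5.neg, ((Real.hasDerivAt_exp y).const_mul δ).add h4, ?_⟩
      have : 0 < δ * Real.exp y := by positivity
      linarith)
  have hψw : streamFunction d η U w = 0 := by
    obtain ⟨x, y⟩ := w
    rcases hbd with hbd | hbd <;> dsimp only at hbd <;> subst hbd
    · exact streamFunction_bed x
    · rw [h.streamFunction_surface, hm]
  have h1 : δ * Real.exp w.2 ≤ ε := hδ w hw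
  have h2 : 0 < δ * Real.exp z.2 := by positivity
  have h3 : δ * Real.exp z.2 + streamFunction d η U z ≤
    δ * Real.exp w.2 + streamFunction d η U w := hmax hz
  linarith

theorem streamFunction_neg (z : ℝ × ℝ) :
    streamFunction d η (fun w => -U w) z = -streamFunction d η U z :=
  intervalIntegral.integral_neg

/-- If the total flux vanishes, so does the velocity. -/
theorem velocity_eq_zero (h : IsPotentialFlow L d η U v) (hL : 0 < L)
    (hm : streamFunction d η U (0, η 0) = 0) : ∀ z ∈ fluidDomain d η, U z = 0 ∧ v z = 0 := by
  have hψ : ∀ z ∈ fluidDomain d η, streamFunction d η U z = 0 := fun z hz => by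
    have h1 := h.streamFunction_nonpos hL hm z hz
    have h2 := h.neg.streamFunction_nonpos hL (by rw [streamFunction_neg, hm, neg_zero]) z hz
    rw [streamFunction_neg] at h2
    linarith
  have hU : ∀ z ∈ fluidDomain d η, U z = 0 := by
    rintro ⟨x, y⟩ hz
    have h1 := (h.hasDerivAt_streamFunction_snd hz).hasDerivWithinAt (s := Icc (-d) (η x))
    have h2 : HasDerivWithinAt (fun s => streamFunction d η U (x, s)) 0 (Icc (-d) (η x)) y :=
      (hasDerivWithinAt_const y _ (0 : ℝ)).congr (fun s hs => hψ (x, s) hs) (hψ _ hz)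
    exact (uniqueDiffOn_Icc (h.above_bed x) y hz).eq_deriv _ h1 h2
  rintro ⟨x, y⟩ hz
  refine ⟨hU _ hz, ?_⟩
  rcases hz.1.eq_or_lt with h₁ | h₁
  · dsimp only at h₁; subst h₁; exact h.bed x
  rcases hz.2.eq_or_lt with h₂ | h₂
  · dsimp only at h₂; subst h₂; rw [h.surface, hU _ hz, zero_mul]
  · have hev := (by fun_prop : ContinuousAt (fun s : ℝ => (s, y)) x).eventually
      (fluidDomain_mem_nhds h.smooth_η.continuous h₁ h₂)
    have h3 := (h.hasDerivAt_streamFunction_fst h₁ h₂).unique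
      ((hasDerivAt_const x (0 : ℝ)).congr_of_eventuallyEq (hev.mono fun s hs => hψ (s, y) hs))
    linarith

end IsPotentialFlow

/-! ### Extrema of the speed -/

namespace IsPotentialFlow

variable {L d : ℝ} {η : ℝ → ℝ} {U v : ℝ × ℝ → ℝ}

/-- The logarithm of the speed is harmonic, and its normal derivative vanishes on the bed, so that
its extrema lie on the free surface. The maximum is the case `σ = 1`, the minimum `σ = -1`. -/
theorem mul_log_speed_le (h : IsPotentialFlow L d η U v) (hL : 0 < L)
    (hU : ∀ z ∈ fluidDomain d η, U z ≠ 0)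
    (hbed : ∀ x, HasDerivWithinAt (fun s => U (x, s) ^ 2 + v (x, s) ^ 2) 0
      (Icc (-d) (η x)) (-d)) {σ C : ℝ}
    (hC : ∀ x, σ * Real.log (U (x, η x) ^ 2 + v (x, η x) ^ 2) ≤ C) :
    ∀ z ∈ fluidDomain d η, σ * Real.log (U z ^ 2 + v z ^ 2) ≤ C := by
  obtain ⟨a, b, hab⟩ := h.hasDerivAt_velocity
  have hq : ∀ z ∈ fluidDomain d η, U z ^ 2 + v z ^ 2 ≠ 0 := fun z hz => by
    have := hU z hz; positivity
  intro z hz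
  refine le_of_forall_pos_le_add fun ε hε => ?_
  obtain ⟨δ, hδpos, hδ⟩ := h.exists_mul_exp_height_le hL hε
  have dqx : ∀ x y, -d < y → y < η x → HasDerivAt (fun s => U (s, y) ^ 2 + v (s, y) ^ 2)
      (2 * (U (x, y) * a (x, y) + v (x, y) * b (x, y))) x := fun x y h₁ h₂ => by
    obtain ⟨ux, -, vx, -⟩ := hab x y h₁ h₂
    exact ((ux.pow 2).add (vx.pow 2)).congr_deriv (by ring)
  have dqy : ∀ x y, -d < y → y < η x → HasDerivAt (fun s => U (x, s) ^ 2 + v (x, s) ^ 2)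
      (2 * (U (x, y) * b (x, y) - v (x, y) * a (x, y))) y := fun x y h₁ h₂ => by
    obtain ⟨-, uy, -, vy, -⟩ := hab x y h₁ h₂
    exact ((uy.pow 2).add (vy.pow 2)).congr_deriv (by ring)
  obtain ⟨w, hw, hmax, hbd⟩ := exists_isMaxOn_boundary hL h.smooth_η.continuous h.above_bed
    h.periodic_η (d := d)
    (F := fun z => δ * Real.exp z.2 + σ * Real.log (U z ^ 2 + v z ^ 2))
    (Fx := fun z => σ * (2 * (U z * a z + v z * b z) / (U z ^ 2 + v z ^ 2)))
    (Fy := fun z => δ * Real.exp z.2 +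
      σ * (2 * (U z * b z - v z * a z) / (U z ^ 2 + v z ^ 2)))
    ((by fun_prop : Continuous fun z : ℝ × ℝ => δ * Real.exp z.2).continuousOn.add
      (continuousOn_const.mul (((h.smooth_U.continuousOn.pow 2).add
        (h.smooth_v.continuousOn.pow 2)).log hq)))
    (fun x y hz => by simp only [h.periodic_U x y hz, h.periodic_v x y hz])
    (fun x y h₁ h₂ => (((dqx x y h₁ h₂).log (hq _ ⟨h₁.le, h₂.le⟩)).const_mul σ).const_add
      (δ * Real.exp y))
    (fun x y h₁ h₂ => ((Real.hasDerivAt_exp y).const_mul δ).add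
      (((dqy x y h₁ h₂).log (hq _ ⟨h₁.le, h₂.le⟩)).const_mul σ))
    (fun x y h₁ h₂ => by
      obtain ⟨ux, uy, vx, vy, A, B, ax, b_y, bx, ay⟩ := hab x y h₁ h₂
      have hq' := hq (x, y) ⟨h₁.le, h₂.le⟩
      refine ⟨_, _, ((((ux.fun_mul ax).fun_add (vx.fun_mul bx)).const_mul 2).div (dqx x y h₁ h₂)
          hq').const_mul σ,
        ((Real.hasDerivAt_exp y).const_mul δ).add
          (((((uy.fun_mul b_y).fun_sub (vy.fun_mul ay)).const_mul 2).div (dqy x y h₁ h₂)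
            hq').const_mul σ), ?_⟩
      have : 0 < δ * Real.exp y := by positivity
      -- the Laplacian of the logarithm cancels
      refine this.trans_eq ?_
      field_simp
      ring)
  have hw' : δ * Real.exp w.2 + σ * Real.log (U w ^ 2 + v w ^ 2) ≤ ε + C := by
    have h1 : δ * Real.exp w.2 ≤ ε := hδ w hw
    obtain ⟨x, y⟩ := w
    rcases hbd with hbd | hbd <;> dsimp only at hbd <;> subst hbd
    · -- on the bed the perturbation increases upwards, which excludes a maximum there
      exfalso
      have hder := (((Real.hasDerivAt_exp (-d)).const_mul δ).hasDerivWithinAt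
        (s := Icc (-d) (η x))).add
        (((hbed x).log (hq _ hw)).const_mul σ)
      have := deriv_nonpos_of_max_left (h.above_bed x) hder fun s hs => hmax (a := (x, s)) hs
      have h2 : 0 < δ * Real.exp (-d) := by positivity
      simp only [zero_div, mul_zero, add_zero] at this h2
      linarith
    · linarith [hC x]
  have h2 : 0 < δ * Real.exp z.2 := by positivity
  have h3 : δ * Real.exp z.2 + σ * Real.log (U z ^ 2 + v z ^ 2) ≤
    δ * Real.exp w.2 + σ * Real.log (U w ^ 2 + v w ^ 2) := hmax hz
  linarith

end IsPotentialFlow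

/-! ### Steady waves -/

namespace IsSteadyWave

variable {L d c g ρ Patm : ℝ} {η : ℝ → ℝ} {u v P : ℝ × ℝ → ℝ}

theorem isPotentialFlow (h : IsSteadyWave L d c g ρ Patm η u v P) :
    IsPotentialFlow L d η (fun z => u z - c) v where
  smooth_η := h.smooth_η
  smooth_U := h.smooth_u.sub contDiffOn_const
  smooth_v := h.smooth_v
  above_bed := h.above_bed
  periodic_η := h.periodic_η
  periodic_U x y hz := by rw [h.periodic_u x y hz]
  periodic_v := h.periodic_v
  incompressible x y h₁ h₂ := by
    have := h.incompressible (x, y) ⟨h₁.le, h₂.le⟩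
    have e : partialX (fluidDomain d η) (fun z => u z - c) (x, y) =
        partialX (fluidDomain d η) u (x, y) := by rw [partialX, fderivWithin_sub_const]; rfl
    linarith
  irrotational x y h₁ h₂ := by
    have := h.irrotational (x, y) ⟨h₁.le, h₂.le⟩
    have e : partialY (fluidDomain d η) (fun z => u z - c) (x, y) =
        partialY (fluidDomain d η) u (x, y) := by rw [partialY, fderivWithin_sub_const]; rfl
    linarith
  bed := h.bed
  surface := h.surface_kinematic

theorem hasDerivAt_bed (h : IsSteadyWave L d c g ρ Patm η u v P) {f : ℝ × ℝ → ℝ}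
    (hf : ContDiffOn ℝ ∞ f (fluidDomain d η)) (x : ℝ) :
    HasDerivAt (fun s => f (s, -d)) (partialX (fluidDomain d η) f (x, -d)) x := by
  have hb : ∀ x, (x, -d) ∈ fluidDomain d η := fun x => ⟨le_rfl, (h.above_bed x).le⟩
  simpa using hasDerivWithinAt_univ.1 (hasDerivWithinAt_comp_curve (a := fun s => s)
    (b := fun _ => -d) ((hf.differentiableOn (by simp)) _ (hb x)) (hasDerivWithinAt_id x univ)
    (hasDerivWithinAt_const x univ (-d)) fun r _ => hb r)

/-- Bernoulli's law. The constant is found by moving along the bed and then upwards. -/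
theorem bernoulli (h : IsSteadyWave L d c g ρ Patm η u v P) (hρ : 0 < ρ) :
    ∃ K, ∀ z ∈ fluidDomain d η,
      dynamicPressure g ρ Patm P z + ρ / 2 * ((u z - c) ^ 2 + v z ^ 2) = K := by
  set E : ℝ × ℝ → ℝ := fun z => P z - (Patm - ρ * g * z.2) +
    ρ / 2 * ((u z - c) ^ 2 + v z ^ 2) with hE
  have hvert : ∀ x, ∀ y ∈ Icc (-d) (η x), E (x, y) = E (x, -d) := fun x => by
    have hder : ∀ y ∈ Icc (-d) (η x),
        HasDerivWithinAt (fun s => E (x, s)) 0 (Icc (-d) (η x)) y := fun y hy => by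
      have hz : (x, y) ∈ fluidDomain d η := hy
      have dP := hasDerivWithinAt_vertical h.smooth_P hz
      have du := hasDerivWithinAt_vertical h.smooth_u hz
      have dv := hasDerivWithinAt_vertical h.smooth_v hz
      have dy := ((hasDerivWithinAt_id y (Icc (-d) (η x))).const_mul (ρ * g)).const_sub Patm
      refine ((dP.sub dy).add (((((du.sub_const c).pow 2).add (dv.pow 2))).const_mul
        (ρ / 2))).congr_deriv ?_
      have e1 := h.euler_y _ hz
      have e2 := h.irrotational _ hz
      field_simp at e1
      rw [← e2] at e1
      linear_combination e1
    refine constant_of_derivWithin_zero (fun y hy => (hder y hy).differentiableWithinAt)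
      fun y hy => (hder y (Ico_subset_Icc_self hy)).derivWithin
        (uniqueDiffOn_Icc (h.above_bed x) y (Ico_subset_Icc_self hy))
  have hbed : ∀ x, HasDerivAt (fun s => E (s, -d)) 0 x := fun x => by
    have hz : (x, -d) ∈ fluidDomain d η := ⟨le_rfl, (h.above_bed x).le⟩
    refine (((h.hasDerivAt_bed h.smooth_P x).sub_const (Patm - ρ * g * (-d))).add
      ((((((h.hasDerivAt_bed h.smooth_u x).sub_const c).pow 2).add
        ((h.hasDerivAt_bed h.smooth_v x).pow 2))).const_mul (ρ / 2))).congr_deriv ?_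
    have e1 := h.euler_x _ hz
    have e2 := h.irrotational _ hz
    field_simp at e1
    rw [e2] at e1
    linear_combination e1
  refine ⟨E (0, -d), fun z hz => (hvert z.1 z.2 hz).trans ?_⟩
  exact is_const_of_deriv_eq_zero (fun x => (hbed x).differentiableAt)
    (fun x => (hbed x).deriv) z.1 0

/-- On the bed `v = 0` and `u_y = v_x = 0`, so the speed has no normal derivative there. -/
theorem hasDerivWithinAt_speed_bed (h : IsSteadyWave L d c g ρ Patm η u v P) (x : ℝ) :
    HasDerivWithinAt (fun s => (u (x, s) - c) ^ 2 + v (x, s) ^ 2) 0 (Icc (-d) (η x)) (-d) := by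
  have hz : (x, -d) ∈ fluidDomain d η := ⟨le_rfl, (h.above_bed x).le⟩
  have hvx : partialX (fluidDomain d η) v (x, -d) = 0 := by
    refine (h.hasDerivAt_bed h.smooth_v x).unique ?_
    simpa only [h.bed] using hasDerivAt_const x (0 : ℝ)
  have huy : partialY (fluidDomain d η) u (x, -d) = 0 := (h.irrotational _ hz).trans hvx
  refine ((((hasDerivWithinAt_vertical h.smooth_u hz).sub_const c).pow 2).add
    ((hasDerivWithinAt_vertical h.smooth_v hz).pow 2)).congr_deriv ?_
  simp [huy, h.bed]

theorem currentStrength_sub (h : IsSteadyWave L d c g ρ Patm η u v P) (hL : 0 < L) :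
    IntervalIntegrable (fun x => u (x, -d) - c) MeasureTheory.volume 0 L ∧
    ∫ x in (0 : ℝ)..L, (u (x, -d) - c) = L * (currentStrength L d u - c) := by
  have hc : Continuous fun x => u (x, -d) :=
    h.smooth_u.continuousOn.comp_continuous (by fun_prop) fun x => ⟨le_rfl, (h.above_bed x).le⟩
  refine ⟨(hc.sub continuous_const).intervalIntegrable _ _, ?_⟩
  rw [intervalIntegral.integral_sub (hc.intervalIntegrable _ _)
    (continuous_const.intervalIntegrable _ _), currentStrength, intervalIntegral.integral_const]
  field_simp
  simp

/-- The sign of the total flux determines that of `u - c`, and, by averaging over the bed, that of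
the relative current strength. -/
theorem current_trichotomy (h : IsSteadyWave L d c g ρ Patm η u v P) (hL : 0 < L) :
    (c < currentStrength L d u ∧ ∀ z ∈ fluidDomain d η, c < u z) ∨
    (currentStrength L d u < c ∧ ∀ z ∈ fluidDomain d η, u z < c) ∨
    (currentStrength L d u = c ∧ ∀ z ∈ fluidDomain d η, u z = c ∧ v z = 0) := by
  have hf := h.isPotentialFlow
  obtain ⟨hint, hk⟩ := h.currentStrength_sub hL
  have hb : ∀ x, (x, -d) ∈ fluidDomain d η := fun x => ⟨le_rfl, (h.above_bed x).le⟩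
  rcases lt_trichotomy (streamFunction d η (fun z => u z - c) (0, η 0)) 0 with hm | hm | hm
  · have hpos := hf.neg.velocity_pos hL (by
      rw [IsPotentialFlow.streamFunction_neg]; linarith)
    refine .inr (.inl ⟨?_, fun z hz => by linarith [hpos z hz]⟩)
    have := intervalIntegral.intervalIntegral_pos_of_pos hint.neg
      (fun x => hpos _ (hb x)) hL
    have e : ∫ x in (0 : ℝ)..L, -(u (x, -d) - c) = -(L * (currentStrength L d u - c)) := by
      rw [intervalIntegral.integral_neg, hk]
    have h2 : 0 < L * (c - currentStrength L d u) := by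
      refine this.trans_eq (Eq.trans e ?_); ring
    linarith [pos_of_mul_pos_right h2 hL.le]
  · have h0 := hf.velocity_eq_zero hL hm
    refine .inr (.inr ⟨?_, fun z hz => ⟨by linarith [(h0 z hz).1], (h0 z hz).2⟩⟩)
    have e : ∫ x in (0 : ℝ)..L, (u (x, -d) - c) = 0 := by
      simp [fun x => (h0 _ (hb x)).1]
    rw [e] at hk
    rcases mul_eq_zero.1 hk.symm with h1 | h1
    · exact absurd h1 hL.ne'
    · linarith
  · have hpos := hf.velocity_pos hL hm
    refine .inl ⟨?_, fun z hz => by linarith [hpos z hz]⟩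
    have := intervalIntegral.intervalIntegral_pos_of_pos hint (fun x => hpos _ (hb x)) hL
    rw [hk] at this
    linarith [pos_of_mul_pos_right this hL.le]

theorem dynamicPressure_surface (h : IsSteadyWave L d c g ρ Patm η u v P) (x : ℝ) :
    dynamicPressure g ρ Patm P (x, η x) = ρ * g * η x := by
  simp [dynamicPressure, h.surface_dynamic x]

/-- In a fluid at rest relative to the wave the dynamic pressure is constant, and it equals `ρ g η`
on the surface, so that `η` equals its mean value `0`. -/
theorem eq_zero_of_trivial_flow (h : IsSteadyWave L d c g ρ Patm η u v P) (hL : 0 < L)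
    (hg : 0 < g) (hρ : 0 < ρ) (h0 : ∀ z ∈ fluidDomain d η, u z = c ∧ v z = 0) :
    (∀ x, η x = 0) ∧ ∀ z ∈ fluidDomain d η, dynamicPressure g ρ Patm P z = 0 := by
  obtain ⟨K, hK⟩ := h.bernoulli hρ
  have hp : ∀ z ∈ fluidDomain d η, dynamicPressure g ρ Patm P z = K := fun z hz => by
    simpa [(h0 z hz).1, (h0 z hz).2] using hK z hz
  have hηK : ∀ x, ρ * g * η x = K := fun x => by
    rw [← h.dynamicPressure_surface]; exact hp _ ⟨(h.above_bed x).le, le_rfl⟩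
  have hconst : ∀ x, η x = η 0 := fun x =>
    mul_left_cancel₀ (mul_pos hρ hg).ne' ((hηK x).trans (hηK 0).symm)
  have hη0 : η 0 = 0 := by
    have := h.mean_level
    simp only [hconst, intervalIntegral.integral_const, sub_zero, smul_eq_mul] at this
    rcases mul_eq_zero.1 this with h1 | h1
    · exact absurd h1 hL.ne'
    · exact h1
  refine ⟨fun x => (hconst x).trans hη0, fun z hz => ?_⟩
  rw [hp z hz, ← hηK 0, hη0, mul_zero]

/-- Where the flow has no stagnation point, the dynamic pressure in the fluid lies between its
values at any highest and any lowest point of the free surface. -/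
theorem dynamicPressure_extrema (h : IsSteadyWave L d c g ρ Patm η u v P) (hL : 0 < L)
    (hg : 0 < g) (hρ : 0 < ρ) (hU : ∀ z ∈ fluidDomain d η, u z - c ≠ 0) {x₀ x₁ : ℝ}
    (hmax : ∀ x, η x ≤ η x₀) (hmin : ∀ x, η x₁ ≤ η x) :
    IsMaxOn (dynamicPressure g ρ Patm P) (fluidDomain d η) (x₀, η x₀) ∧
      IsMinOn (dynamicPressure g ρ Patm P) (fluidDomain d η) (x₁, η x₁) := by
  obtain ⟨K, hK⟩ := h.bernoulli hρ
  have hs : ∀ x, (x, η x) ∈ fluidDomain d η := fun x => ⟨(h.above_bed x).le, le_rfl⟩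
  have hq : ∀ z ∈ fluidDomain d η, 0 < (u z - c) ^ 2 + v z ^ 2 := fun z hz => by
    have := hU z hz; positivity
  have hρg := mul_pos hρ hg
  have hord : ∀ x x', η x ≤ η x' → (u (x', η x') - c) ^ 2 + v (x', η x') ^ 2 ≤
      (u (x, η x) - c) ^ 2 + v (x, η x) ^ 2 := fun x x' hx => by
    have e1 := hK _ (hs x)
    have e2 := hK _ (hs x')
    rw [h.dynamicPressure_surface] at e1 e2
    have e3 := mul_le_mul_of_nonneg_left hx hρg.le
    exact le_of_mul_le_mul_left (by linarith) (half_pos hρ)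
  have hle := fun {σ C : ℝ} => h.isPotentialFlow.mul_log_speed_le hL hU
    h.hasDerivWithinAt_speed_bed (σ := σ) (C := C)
  constructor
  · intro z hz
    have h1 := hle (σ := -1)
      (C := -Real.log ((u (x₀, η x₀) - c) ^ 2 + v (x₀, η x₀) ^ 2)) (fun x => by
      simpa using Real.log_le_log (hq _ (hs x₀)) (hord x x₀ (hmax x))) z hz
    have h2 : (u (x₀, η x₀) - c) ^ 2 + v (x₀, η x₀) ^ 2 ≤ (u z - c) ^ 2 + v z ^ 2 :=
      (Real.log_le_log_iff (hq _ (hs x₀)) (hq z hz)).1 (by linarith)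
    have e1 := hK _ (hs x₀)
    have e2 := hK z hz
    change dynamicPressure g ρ Patm P z ≤ dynamicPressure g ρ Patm P (x₀, η x₀)
    nlinarith
  · intro z hz
    have h1 := hle (σ := 1)
      (C := Real.log ((u (x₁, η x₁) - c) ^ 2 + v (x₁, η x₁) ^ 2)) (fun x => by
      simpa using Real.log_le_log (hq _ (hs x)) (hord x₁ x (hmin x))) z hz
    have h2 : (u z - c) ^ 2 + v z ^ 2 ≤ (u (x₁, η x₁) - c) ^ 2 + v (x₁, η x₁) ^ 2 :=
      (Real.log_le_log_iff (hq z hz) (hq _ (hs x₁))).1 (by linarith)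
    have e1 := hK _ (hs x₁)
    have e2 := hK z hz
    change dynamicPressure g ρ Patm P (x₁, η x₁) ≤ dynamicPressure g ρ Patm P z
    nlinarith

end IsSteadyWave

/-- An even periodic profile that decreases from `0` to half a period is highest at `0` and lowest
at half a period. -/
theorem extrema_of_even_periodic {L : ℝ} (hL : 0 < L) {η : ℝ → ℝ} (hper : ∀ x, η (x + L) = η x)
    (heven : ∀ x, η (-x) = η x) (hanti : StrictAntiOn η (Icc 0 (L / 2))) (x : ℝ) :
    η (L / 2) ≤ η x ∧ η x ≤ η 0 := by
  obtain ⟨n, hn, -⟩ := existsUnique_add_zsmul_mem_Ico hL x (-(L / 2))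
  have e : η |x + n • L| = η x := by
    rw [← (show Function.Periodic η L from hper).zsmul n x]
    rcases abs_choice (x + n • L) with h | h <;> rw [h]
    exact heven _
  have hmem : |x + n • L| ∈ Icc 0 (L / 2) :=
    ⟨abs_nonneg _, abs_le.2 ⟨hn.1, by linarith [hn.2]⟩⟩
  rw [← e]
  exact ⟨hanti.antitoneOn hmem ⟨by linarith, le_rfl⟩ hmem.2,
    hanti.antitoneOn ⟨le_rfl, by linarith⟩ hmem hmem.1⟩

end WaterWave

theorem theorem1 (L d c g ρ Patm k : ℝ) (hL : 0 < L) (hd : 0 < d) (hc : 0 < c) (hg : 0 < g)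
    (hρ : 0 < ρ) (η : ℝ → ℝ) (u v P : ℝ × ℝ → ℝ)
    (hwave : WaterWave.IsSteadyWave L d c g ρ Patm η u v P)
    (hk : k = WaterWave.currentStrength L d u) (hk0 : k ≠ 0) :
    -- extrema of the dynamic pressure of a regular wave train at the crest and the trough
    (WaterWave.IsRegularWaveTrain L d c g ρ Patm η u v P → k ≠ c →
      IsMaxOn (WaterWave.dynamicPressure g ρ Patm P) (WaterWave.fluidDomain d η) (0, η 0) ∧
      IsMinOn (WaterWave.dynamicPressure g ρ Patm P) (WaterWave.fluidDomain d η)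
        (L / 2, η (L / 2))) ∧
    -- the trivial flow
    (k = c →
      (∀ x, η x = 0) ∧
      ∀ z ∈ WaterWave.fluidDomain d η,
        u z = c ∧ v z = 0 ∧ WaterWave.dynamicPressure g ρ Patm P z = 0) ∧
    -- the sign of the relative horizontal velocity
    (c < k → ∀ z ∈ WaterWave.fluidDomain d η, c < u z) ∧
    (k < c → ∀ z ∈ WaterWave.fluidDomain d η, u z < c) := by
  subst hk
  rcases hwave.current_trichotomy hL with ⟨hk, hu⟩ | ⟨hk, hu⟩ | ⟨hk, hu⟩
  · refine ⟨fun hr _ => ?_, fun h => absurd h hk.ne', fun _ => hu, fun h => absurd h hk.not_gt⟩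
    have hη := WaterWave.extrema_of_even_periodic hL hr.periodic_η hr.symm_η hr.strictAnti_η
    exact hwave.dynamicPressure_extrema hL hg hρ (fun z hz => (sub_pos.2 (hu z hz)).ne')
      (fun x => (hη x).2) fun x => (hη x).1
  · refine ⟨fun hr _ => ?_, fun h => absurd h hk.ne, fun h => absurd h hk.not_gt, fun _ => hu⟩
    have hη := WaterWave.extrema_of_even_periodic hL hr.periodic_η hr.symm_η hr.strictAnti_η
    exact hwave.dynamicPressure_extrema hL hg hρ (fun z hz => (sub_neg.2 (hu z hz)).ne)
      (fun x => (hη x).2) fun x => (hη x).1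
  · obtain ⟨hη, hp⟩ := hwave.eq_zero_of_trivial_flow hL hg hρ hu
    exact ⟨fun _ h => absurd hk h, fun _ => ⟨hη, fun z hz => ⟨(hu z hz).1, (hu z hz).2, hp z hz⟩⟩,
      fun h => absurd hk h.ne', fun h => absurd hk h.ne⟩
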